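/- Let $(Z_j)_{j\ge1}$ and $(W_j)_{j\ge1}$ be two sequences of i.i.d. real random variables on a probability space, such that $\sigma(Z_j,j\ge1)$ and $\sigma(W_j,j\ge1)$ are independent. Assume: (i) $Z_1$ is not concentrated on one point; if $Z_1$ is lattice valued, then there are an interval $[c_0,d_0]$, $c_0<d_0$, and $p>0$ such that the density of the absolutely continuous part of the law of $W_1$ is at least $p$ (almost everywhere) on $[c_0,d_0]$; if $Z_1$ has a density, then $\mathbb P(|W_1|>0)>0$; (ii) $M(\vartheta)=\mathbb E[e^{\vartheta Z_1}]<\infty$ for all $\vartheta\in\mathbb R$; (iii) with $f=\log M$, both $\mathbb E[f(\vartheta W_1)]$ and $\mathbb E[W_1f'(\vartheta W_1)]$ are finite for all $\vartheta\in\mathbb R$; (iv) there is $F:\mathbb R\to\mathbb R$ with $\mathbb E[F(W_1)]<\infty$ and $W_1^2f''(\vartheta W_1)\le F(W_1)$ almost surely, for all $\vartheta\in\mathbb R$. Put $g(\vartheta)=\mathbb E[f(W_1\vartheta)]$ and $X_n(\vartheta)=n^{-1/2}\sum_{j=1}^n\bigl(f(W_j\vartheta)-\mathbb E[f(W_j\vartheta)]\bigr)$.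 Fix $\vartheta_*>0$, let $J=\bigl(\mathbb E[W_1]\mathbb E[Z_1],\,\mathbb E[W_1f'(\vartheta_*W_1)]\bigr)$, let $\bar J$ be its closure, and let $\vartheta(a)$ be the solution of $a=g'(\vartheta)$. For $k\ge0$ write $\xi^{(k)}_a=W_1^kf^{(k)}(\vartheta(a)W_1)$. Assume that there is $c>0$ with $g''(\vartheta(a))>c$ for all $a\in\bar J$, and that (Assumption Cov) there is $C<\infty$ such that for all $a,a'\in\bar J$ the covariances $\mathrm{Cov}(\xi^{(i)}_a,\xi^{(k)}_{a'})$, $i,k\in\{0,1,2\}$, and the variance $\mathrm{Var}(\xi^{(3)}_a)$ are well defined (the variables involved are square integrable) and are all smaller than $C$. Then the processes $\widehat X^n_a=(X_n(\vartheta(a)),X_n'(\vartheta(a)),X_n''(\vartheta(a)))$, $a\in\bar J$, have continuous paths and, as random elements of $C(\bar J,\mathbb R^3)$ with its Borel $\sigma$-algebra, converge weakly as $n\to\infty$ to a Gaussian process $(\widehat X_a)_{a\in\bar J}$ on the same space, which has mean zero and covariances $\mathrm{Cov}\bigl((\widehat X_a)_i,(\widehat X_{a'})_k\bigr)=\mathrm{Cov}(\xi^{(i)}_a,\xi^{(k)}_{a'})$,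 $i,k\in\{0,1,2\}$. -/

import Mathlib

open MeasureTheory ProbabilityTheory Filter Topology

noncomputable section

/-- `ℝ³` with its Euclidean norm. -/
abbrev R3 : Type := EuclideanSpace ℝ (Fin 3)

/-- The Borel `σ`-algebra on a space of continuous functions; the topology of `C(S, E)` is the
compact-open one, which for compact `S` is the topology of uniform convergence. -/
instance continuousMapBorel {S E : Type*} [TopologicalSpace S] [TopologicalSpace E] :
    MeasurableSpace C(S, E) := borel _

instance {S E : Type*} [TopologicalSpace S] [TopologicalSpace E] : BorelSpace C(S, E) := ⟨rfl⟩

variable {Ω : Type*} [MeasurableSpace Ω]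

/-- `f(ϑ) = log E[exp(ϑ Z₁)]`. Sequences are indexed from `0`, so `Z 0` and `W 0` are the
first weights and summands `Z₁` and `W₁`. -/
def logMgf (P : Measure Ω) (Z : ℕ → Ω → ℝ) : ℝ → ℝ := cgf (Z 0) P

/-- `g(ϑ) = E[f(W₁ ϑ)]`. -/
def meanLogMgf (P : Measure Ω) (W Z : ℕ → Ω → ℝ) (t : ℝ) : ℝ :=
  ∫ ω, logMgf P Z (W 0 ω * t) ∂P

/-- `ϑ(a)`, the solution `ϑ` of the equation `a = g'(ϑ)`. -/
def tilt (P : Measure Ω) (W Z : ℕ → Ω → ℝ) (a : ℝ) : ℝ :=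
  Function.invFun (deriv (meanLogMgf P W Z)) a

/-- The open interval `J = (E[W₁] E[Z₁], E[W₁ f'(ϑ_* W₁)])`. -/
def intervalJ (P : Measure Ω) (W Z : ℕ → Ω → ℝ) (tstar : ℝ) : Set ℝ :=
  Set.Ioo ((∫ ω, W 0 ω ∂P) * ∫ ω, Z 0 ω ∂P)
    (∫ ω, W 0 ω * deriv (logMgf P Z) (tstar * W 0 ω) ∂P)

/-- The closure of `J`. -/
abbrev closureJ (P : Measure Ω) (W Z : ℕ → Ω → ℝ) (tstar : ℝ) : Set ℝ :=
  closure (intervalJ P W Z tstar)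

/-- `X_n(ϑ) = n^{-1/2} ∑_{j ≤ n} (f(W_j ϑ) - E[f(W_j ϑ)])`, as a function of `ϑ` for fixed `ω`. -/
def fluctuation (P : Measure Ω) (W Z : ℕ → Ω → ℝ) (n : ℕ) (ω : Ω) (t : ℝ) : ℝ :=
  (√(n : ℝ))⁻¹ *
    ∑ j ∈ Finset.range n, (logMgf P Z (W j ω * t) - ∫ ω', logMgf P Z (W j ω' * t) ∂P)

/-- The triple `(X_n(ϑ(a)), X_n'(ϑ(a)), X_n''(ϑ(a)))`. -/
def tripleProcess (P : Measure Ω) (W Z : ℕ → Ω → ℝ) (n : ℕ) (ω : Ω) (a : ℝ) : R3 :=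
  !₂[fluctuation P W Z n ω (tilt P W Z a),
    deriv (fluctuation P W Z n ω) (tilt P W Z a),
    iteratedDeriv 2 (fluctuation P W Z n ω) (tilt P W Z a)]

/-- The random variable `W₁^k f^{(k)}(ϑ(a) W₁)`. -/
def derivTerm (P : Measure Ω) (W Z : ℕ → Ω → ℝ) (k : ℕ) (a : ℝ) (ω : Ω) : ℝ :=
  W 0 ω ^ k * iteratedDeriv k (logMgf P Z) (tilt P W Z a * W 0 ω)

/-- `X` takes values in a lattice `b + h ℤ`, almost surely. -/
def LatticeValued (P : Measure Ω) (X : Ω → ℝ) : Prop :=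
  ∃ b h : ℝ, 0 < h ∧ ∀ᵐ ω ∂P, ∃ k : ℤ, X ω = b + h * k

/-- The standing assumptions on the sequences `(W_j)` and `(Z_j)`. -/
structure StandingAssumptions (P : Measure Ω) (W Z : ℕ → Ω → ℝ) : Prop where
  measurable_W : ∀ j, Measurable (W j)
  measurable_Z : ∀ j, Measurable (Z j)
  /-- `(W_j)` is i.i.d. -/
  indep_W : iIndepFun W P
  identDistrib_W : ∀ j, IdentDistrib (W j) (W 0) P P
  /-- `(Z_j)` is i.i.d. -/
  indep_Z : iIndepFun Z P
  identDistrib_Z : ∀ j, IdentDistrib (Z j) (Z 0) P P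
  /-- `σ(W_j, j ∈ ℕ)` and `σ(Z_j, j ∈ ℕ)` are independent. -/
  indep_WZ : IndepFun (fun ω j => W j ω) (fun ω j => Z j ω) P
  /-- `Z₁` is not concentrated on one point. -/
  nondegenerate : ¬ ∃ z : ℝ, ∀ᵐ ω ∂P, Z 0 ω = z
  /-- If `Z₁` is lattice valued, the density of the absolutely continuous part of the law of `W₁`
  is bounded from below by some `p > 0` on some interval `[c, d]`. -/
  lattice : LatticeValued P (Z 0) → ∃ c d p : ℝ, c < d ∧ 0 < p ∧
    ∀ᵐ x ∂(volume.restrict (Set.Icc c d)), ENNReal.ofReal p ≤ (P.map (W 0)).rnDeriv volume x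
  /-- If `Z₁` has a density, then `P(|W₁| > 0) > 0`. -/
  density : P.map (Z 0) ≪ volume → 0 < P {ω | 0 < |W 0 ω|}
  /-- The moment generating function of `Z₁` is finite on `ℝ`. -/
  mgf_finite : ∀ t : ℝ, Integrable (fun ω => Real.exp (t * Z 0 ω)) P
  /-- `E[f(ϑ W₁)]` and `E[W₁ f'(ϑ W₁)]` are finite for all `ϑ`. -/
  integrable_f : ∀ t : ℝ, Integrable (fun ω => logMgf P Z (t * W 0 ω)) P
  integrable_f' : ∀ t : ℝ, Integrable (fun ω => W 0 ω * deriv (logMgf P Z) (t * W 0 ω)) P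
  /-- `W₁² f''(ϑ W₁) ≤ F(W₁)` for all `ϑ`, with `E[F(W₁)] < ∞`. -/
  majorant : ∃ F : ℝ → ℝ, Integrable (fun ω => F (W 0 ω)) P ∧
    ∀ t : ℝ, ∀ᵐ ω ∂P, W 0 ω ^ 2 * iteratedDeriv 2 (logMgf P Z) (t * W 0 ω) ≤ F (W 0 ω)

/-- The covariance assumption: for `a, a'` in the closure of `J`, the covariances of
`W₁^i f^{(i)}(ϑ(a) W₁)` and `W₁^k f^{(k)}(ϑ(a') W₁)`, `i, k ∈ {0, 1, 2}`, and the variance of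
`W₁³ f'''(ϑ(a) W₁)` exist and are all smaller than a constant `C`. -/
structure CovAssumption (P : Measure Ω) (W Z : ℕ → Ω → ℝ) (tstar : ℝ) : Prop where
  memLp : ∀ k ≤ 3, ∀ a ∈ closureJ P W Z tstar, MemLp (derivTerm P W Z k a) 2 P
  bound : ∃ C : ℝ,
    (∀ a ∈ closureJ P W Z tstar, ∀ a' ∈ closureJ P W Z tstar, ∀ i ≤ 2, ∀ k ≤ 2,
      cov[derivTerm P W Z i a, derivTerm P W Z k a'; P] < C) ∧
    ∀ a ∈ closureJ P W Z tstar, Var[derivTerm P W Z 3 a; P] < C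

end

/-- The normalized partial sums `n^{-1/2} ∑_{j < n} X_j`. -/
noncomputable def normalizedSum {Ω E : Type*} [AddCommGroup E] [Module ℝ E] (X : ℕ → Ω → E)
    (n : ℕ) (ω : Ω) : E :=
  (√(n : ℝ))⁻¹ • ∑ j ∈ Finset.range n, X j ω

lemma measurable_normalizedSum {Ω E : Type*} [MeasurableSpace Ω]
    [NormedAddCommGroup E] [NormedSpace ℝ E] [SecondCountableTopology E]
    [MeasurableSpace E] [BorelSpace E] {X : ℕ → Ω → E}
    (hX : ∀ j, Measurable (X j)) (n : ℕ) : Measurable (normalizedSum X n) :=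
  (Finset.measurable_fun_sum _ fun j _ ↦ hX j).const_smul _

lemma dual_normalizedSum {Ω E : Type*} [NormedAddCommGroup E] [NormedSpace ℝ E]
    {X : ℕ → Ω → E} (L : StrongDual ℝ E) (n : ℕ) (ω : Ω) :
    L (normalizedSum X n ω) = (√(n : ℝ))⁻¹ * ∑ j ∈ Finset.range n, L (X j ω) := by
  simp [normalizedSum]

/-- The one-dimensional central limit theorem for continuous linear functionals. -/
lemma tendsto_dual_normalizedSum {Ω E : Type*} [MeasurableSpace Ω] {P : Measure Ω}
    [IsProbabilityMeasure P] [NormedAddCommGroup E] [NormedSpace ℝ E] [MeasurableSpace E]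
    [BorelSpace E] {X : ℕ → Ω → E} (hindep : iIndepFun X P)
    (hident : ∀ j, IdentDistrib (X j) (X 0) P P) (L : StrongDual ℝ E)
    (hL2 : MemLp (fun ω ↦ L (X 0 ω)) 2 P) (hmean : ∫ ω, L (X 0 ω) ∂P = 0) :
    TendstoInDistribution (fun n ω ↦ L (normalizedSum X n ω)) atTop id (fun _ ↦ P)
      (gaussianReal 0 Var[fun ω ↦ L (X 0 ω); P].toNNReal) := by
  have h := tendstoInDistribution_inv_sqrt_mul_sum_sub (P := P)
    (P' := gaussianReal 0 Var[fun ω ↦ L (X 0 ω); P].toNNReal) (Y := id)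
    (X := fun j ω ↦ L (X j ω)) ⟨by fun_prop, by simp⟩ hL2
    (hindep.comp (fun _ ↦ L) fun _ ↦ L.continuous.measurable)
    (fun j ↦ (hident j).comp L.continuous.measurable)
  simpa [dual_normalizedSum, hmean] using h

/-- A tight sequence of normalized sums of i.i.d. weakly square integrable centred random elements
of a separable Banach space converges in distribution to a centred Gaussian measure. -/
theorem exists_tendstoInDistribution_normalizedSum {Ω E : Type*} [MeasurableSpace Ω]
    {P : Measure Ω} [IsProbabilityMeasure P] [NormedAddCommGroup E] [NormedSpace ℝ E]
    [CompleteSpace E] [SecondCountableTopology E] [MeasurableSpace E] [BorelSpace E]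
    {X : ℕ → Ω → E} (hX : ∀ j, Measurable (X j))
    (hindep : iIndepFun X P) (hident : ∀ j, IdentDistrib (X j) (X 0) P P)
    (hL2 : ∀ L : StrongDual ℝ E, MemLp (fun ω ↦ L (X 0 ω)) 2 P)
    (hmean : ∀ L : StrongDual ℝ E, ∫ ω, L (X 0 ω) ∂P = 0)
    (htight : IsTightMeasureSet {ν | ∃ n, P.map (normalizedSum X n) = ν}) :
    ∃ μ : ProbabilityMeasure E,
      TendstoInDistribution (normalizedSum X) atTop (id : E → E) (fun _ ↦ P) (μ : Measure E) ∧
      ∀ L : StrongDual ℝ E, (μ : Measure E).map L =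
        gaussianReal 0 Var[fun ω ↦ L (X 0 ω); P].toNNReal := by
  have hY := measurable_normalizedSum hX
  let ν : ℕ → ProbabilityMeasure E := fun n ↦
    ⟨P.map (normalizedSum X n), Measure.isProbabilityMeasure_map (hY n).aemeasurable⟩
  have hcomp : IsCompact (closure (Set.range ν)) := by
    refine isCompact_closure_of_isTightMeasureSet (htight.subset ?_)
    rintro _ ⟨_, ⟨n, rfl⟩, rfl⟩
    exact ⟨n, rfl⟩
  have hlaw (U : Ultrafilter ℕ) (hU : (U : Filter ℕ) ≤ atTop) (μ : ProbabilityMeasure E)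
      (hμ : Tendsto ν U (𝓝 μ)) (L : StrongDual ℝ E) : (μ : Measure E).map L =
        gaussianReal 0 Var[fun ω ↦ L (X 0 ω); P].toNNReal := by
    have h1 := ProbabilityMeasure.tendsto_map_of_tendsto_of_continuous _ _ hμ L.continuous
    have h2 := (tendsto_dual_normalizedSum hindep hident L (hL2 L) (hmean L)).tendsto.mono_left
      hU
    have h3 := tendsto_nhds_unique (h1.congr fun n ↦ ?_) h2
    · simpa using congrArg (fun ρ : ProbabilityMeasure ℝ ↦ (ρ : Measure ℝ)) h3
    · apply Subtype.ext
      exact Measure.map_map L.continuous.measurable (hY n)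
  have hlim (U : Ultrafilter ℕ) : ∃ μ : ProbabilityMeasure E, Tendsto ν U (𝓝 μ) := by
    obtain ⟨μ, -, hμ⟩ := hcomp.ultrafilter_le_nhds (U.map ν)
      (.trans (by simp) (monotone_principal subset_closure))
    exact ⟨μ, hμ⟩
  obtain ⟨μ, hμ⟩ := hlim (hyperfilter ℕ)
  have hμL := hlaw _ Nat.hyperfilter_le_atTop μ hμ
  refine ⟨μ, ⟨fun n ↦ (hY n).aemeasurable, aemeasurable_id, ?_⟩, hμL⟩
  have key : Tendsto ν atTop (𝓝 μ) := by
    refine (tendsto_iff_ultrafilter _ _ _).2 fun U hU ↦ ?_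
    obtain ⟨μ', hμ'⟩ := hlim U
    suffices μ' = μ by rwa [this] at hμ'
    apply Subtype.ext
    have := μ'.2
    have := μ.2
    refine Measure.ext_of_charFunDual (μ := μ'.1) (ν := μ.1) (funext fun L ↦ ?_)
    rw [charFunDual_eq_charFun_map_one, charFunDual_eq_charFun_map_one]
    exact congrArg (charFun · 1) ((hlaw U hU μ' hμ' L).trans (hμL L).symm)
  convert! key using 2
  congr 1
  apply Subtype.ext
  simp

section Gaussian

variable {Ω E : Type*} [MeasurableSpace Ω] {P : Measure Ω} [NormedAddCommGroup E]
  [NormedSpace ℝ E] [MeasurableSpace E] [BorelSpace E] {μ : Measure E} {V : Ω → E}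

lemma isGaussian_of_map_dual
    (h : ∀ L : StrongDual ℝ E, μ.map L = gaussianReal 0 Var[fun ω ↦ L (V ω); P].toNNReal) :
    IsGaussian μ :=
  isGaussian_of_isGaussian_map fun L ↦ by rw [h L]; infer_instance

lemma integral_dual_eq_zero
    (h : ∀ L : StrongDual ℝ E, μ.map L = gaussianReal 0 Var[fun ω ↦ L (V ω); P].toNNReal)
    (L : StrongDual ℝ E) : ∫ x, L x ∂μ = 0 := by
  have := integral_map (μ := μ) L.continuous.aemeasurable
    (f := id) aestronglyMeasurable_id
  simpa [h L] using this.symm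

lemma covariance_dual_eq [IsProbabilityMeasure P] [CompleteSpace E] [SecondCountableTopology E]
    (h : ∀ L : StrongDual ℝ E, μ.map L = gaussianReal 0 Var[fun ω ↦ L (V ω); P].toNNReal)
    (hL2 : ∀ L : StrongDual ℝ E, MemLp (fun ω ↦ L (V ω)) 2 P) (L L' : StrongDual ℝ E) :
    cov[L, L'; μ] = cov[fun ω ↦ L (V ω), fun ω ↦ L' (V ω); P] := by
  have := isGaussian_of_map_dual h
  have hvar (L : StrongDual ℝ E) : Var[L; μ] = Var[fun ω ↦ L (V ω); P] := by
    have h1 : Var[id; μ.map L] = Var[L; μ] :=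
      variance_map aemeasurable_id L.continuous.aemeasurable
    rw [← h1, h L, variance_id_gaussianReal, Real.coe_toNNReal _ (variance_nonneg _ _)]
  have hmem (L : StrongDual ℝ E) : MemLp L 2 μ := IsGaussian.memLp_dual μ L 2 (by simp)
  have e1 := variance_add (hmem L) (hmem L')
  have e2 := variance_add (hL2 L) (hL2 L')
  have e3 := hvar (L + L')
  have e4 : (fun ω ↦ (L + L') (V ω)) = (fun ω ↦ L (V ω)) + fun ω ↦ L' (V ω) := by
    ext; simp
  rw [e4, e2, ← hvar, ← hvar, FunLike.coe_add, e1] at e3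
  linarith

end Gaussian

section CentredSum

variable {Ω : Type*} [MeasurableSpace Ω] {P : Measure Ω} {W : ℕ → Ω → ℝ}

/-- The normalized centred sums `n^{-1/2} ∑_{j < n} (φ(u, W_j) - E[φ(u, W_0)])`. -/
noncomputable def centredSum (P : Measure Ω) (W : ℕ → Ω → ℝ) (φ : ℝ → ℝ → ℝ) (n : ℕ) (u : ℝ)
    (ω : Ω) : ℝ :=
  (√(n : ℝ))⁻¹ * ∑ j ∈ Finset.range n, (φ u (W j ω) - ∫ ω', φ u (W 0 ω') ∂P)

lemma centredSum_one (φ : ℝ → ℝ → ℝ) (u : ℝ) (ω : Ω) :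
    centredSum P W φ 1 u ω = φ u (W 0 ω) - ∫ ω', φ u (W 0 ω') ∂P := by
  simp [centredSum]

lemma memLp_centredSum [IsProbabilityMeasure P] (hident : ∀ j, IdentDistrib (W j) (W 0) P P)
    {φ : ℝ → ℝ → ℝ} {u : ℝ} (hφ : Measurable (φ u)) (hL2 : MemLp (fun ω ↦ φ u (W 0 ω)) 2 P)
    (n : ℕ) : MemLp (centredSum P W φ n u) 2 P :=
  (memLp_finsetSum _ fun j _ ↦
    (((hident j).comp hφ).memLp_iff.2 hL2).sub (memLp_const _)).const_mul _

lemma integral_centredSum_sq_le [IsProbabilityMeasure P] (hindep : iIndepFun W P)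
    (hident : ∀ j, IdentDistrib (W j) (W 0) P P) {φ : ℝ → ℝ → ℝ} {u C : ℝ}
    (hφ : Measurable (φ u)) (hL2 : MemLp (fun ω ↦ φ u (W 0 ω)) 2 P)
    (hvar : Var[fun ω ↦ φ u (W 0 ω); P] ≤ C) (n : ℕ) :
    ∫ ω, centredSum P W φ n u ω ^ 2 ∂P ≤ C := by
  set m := ∫ ω, φ u (W 0 ω) ∂P with hm
  have hmem (j : ℕ) : MemLp (fun ω ↦ φ u (W j ω) - m) 2 P :=
    (((hident j).comp hφ).memLp_iff.2 hL2).sub (memLp_const _)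
  have hmean (j : ℕ) : ∫ ω, (φ u (W j ω) - m) ∂P = 0 := by
    have h := ((hident j).comp hφ).integral_eq
    simp only [Function.comp_apply] at h
    have hint : Integrable (fun ω ↦ φ u (W j ω)) P :=
      (((hident j).comp hφ).memLp_iff.2 hL2).integrable one_le_two
    rw [integral_sub hint (integrable_const _), h]
    simp [hm]
  have hvarj (j : ℕ) : Var[fun ω ↦ φ u (W j ω) - m; P] = Var[fun ω ↦ φ u (W 0 ω); P] :=
    (variance_sub_const ((hident j).comp hφ).aemeasurable_fst.aestronglyMeasurable m).trans
      ((hident j).comp hφ).variance_eq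
  have hzero : ∫ ω, centredSum P W φ n u ω ∂P = 0 := by
    simp only [centredSum]
    rw [integral_const_mul, integral_finsetSum _ fun j _ ↦ (hmem j).integrable (by simp)]
    simp [hmean]
  have h1 : Var[centredSum P W φ n u; P] = ∫ ω, centredSum P W φ n u ω ^ 2 ∂P :=
    variance_of_integral_eq_zero (memLp_centredSum hident hφ hL2 n).aemeasurable hzero
  have h2 : Var[centredSum P W φ n u; P] =
      ((√(n : ℝ))⁻¹) ^ 2 * ∑ j ∈ Finset.range n, Var[fun ω ↦ φ u (W j ω) - m; P] := by
    rw [← IndepFun.variance_sum (fun j _ ↦ hmem j)]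
    · rw [← variance_const_mul]
      congr 1
      ext ω
      simp [centredSum, hm]
    · intro i _ j _ hij
      exact (hindep.indepFun hij).comp (hφ.sub_const m) (hφ.sub_const m)
  rw [← h1, h2]
  simp only [hvarj, Finset.sum_const, Finset.card_range, nsmul_eq_mul, inv_pow,
    Real.sq_sqrt (Nat.cast_nonneg n)]
  rcases Nat.eq_zero_or_pos n with rfl | hn
  · simpa using (variance_nonneg _ _).trans hvar
  · rw [inv_mul_cancel_left₀ (by positivity)]
    exact hvar

end CentredSum

section SquareIntegrable

variable {Ω : Type*} [MeasurableSpace Ω] {P : Measure Ω} [IsProbabilityMeasure P] {T C : ℝ}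

lemma integrable_sq_prod_of_bound {ψ : ℝ → Ω → ℝ}
    (hψ : Measurable (Function.uncurry ψ))
    (hL2 : ∀ u ∈ Set.Icc 0 T, MemLp (ψ u) 2 P)
    (hC : ∀ u ∈ Set.Icc 0 T, ∫ ω, ψ u ω ^ 2 ∂P ≤ C) :
    Integrable (fun p : ℝ × Ω ↦ ψ p.1 p.2 ^ 2) ((volume.restrict (Set.Icc 0 T)).prod P) := by
  have hmeas : AEStronglyMeasurable (fun p : ℝ × Ω ↦ ψ p.1 p.2 ^ 2)
      ((volume.restrict (Set.Icc 0 T)).prod P) :=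
    (Measurable.pow_const hψ 2).aestronglyMeasurable
  rw [integrable_prod_iff hmeas]
  refine ⟨(ae_restrict_iff' measurableSet_Icc).2 (ae_of_all _ fun u hu ↦ (hL2 u hu).integrable_sq),
    Integrable.mono' (integrable_const C) hmeas.norm.integral_prod_right' ?_⟩
  refine (ae_restrict_iff' measurableSet_Icc).2 (ae_of_all _ fun u hu ↦ ?_)
  rw [Real.norm_of_nonneg (integral_nonneg fun _ ↦ norm_nonneg _)]
  simpa using hC u hu

lemma integral_integral_sq_le (hT : 0 ≤ T) {ψ : ℝ → Ω → ℝ}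
    (hψ : Measurable (Function.uncurry ψ))
    (hL2 : ∀ u ∈ Set.Icc 0 T, MemLp (ψ u) 2 P)
    (hC : ∀ u ∈ Set.Icc 0 T, ∫ ω, ψ u ω ^ 2 ∂P ≤ C) :
    ∫ ω, (∫ u in Set.Icc 0 T, ψ u ω ^ 2) ∂P ≤ T * C := by
  have hint := integrable_sq_prod_of_bound hψ hL2 hC
  rw [← integral_integral_swap (f := fun u ω ↦ ψ u ω ^ 2) hint]
  calc ∫ u in Set.Icc 0 T, (∫ ω, ψ u ω ^ 2 ∂P)
      ≤ ∫ _ in Set.Icc 0 T, C :=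
        setIntegral_mono_on hint.integral_prod_left (by simp) measurableSet_Icc hC
    _ = T * C := by simp [hT]

end SquareIntegrable

/-- Cauchy-Schwarz: a function with square integrable derivative is Hölder continuous of
exponent `1/2`. -/
lemma abs_intervalIntegral_le_sqrt_mul_sqrt {T s t : ℝ} {h : ℝ → ℝ}
    (hh : MemLp h 2 (volume.restrict (Set.Icc 0 T))) (hs : s ∈ Set.Icc 0 T)
    (ht : t ∈ Set.Icc 0 T) :
    |∫ u in s..t, h u| ≤ √(∫ u in Set.Icc 0 T, h u ^ 2) * √|t - s| := by
  have hsub : Set.uIoc s t ⊆ Set.Icc 0 T :=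
    Set.uIoc_subset_uIcc.trans (Set.ordConnected_Icc.uIcc_subset hs ht)
  have hh' : MemLp h 2 (volume.restrict (Set.uIoc s t)) :=
    hh.mono_measure (Measure.restrict_mono_set _ hsub)
  have : IsFiniteMeasure (volume.restrict (Set.uIoc s t)) :=
    ⟨by simp [Real.volume_uIoc]⟩
  have hvol : volume.real (Set.uIoc s t) = |t - s| := by
    simp [measureReal_def, Real.volume_uIoc]
  have hcs := integral_mul_le_Lp_mul_Lq_of_nonneg (μ := volume.restrict (Set.uIoc s t))
    (p := 2) (q := 2) (f := fun u ↦ |h u|) (g := fun _ ↦ (1 : ℝ))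
    ⟨by norm_num, by norm_num, by norm_num⟩
    (ae_of_all _ fun _ ↦ abs_nonneg _) (ae_of_all _ fun _ ↦ zero_le_one)
    (by simpa using hh'.norm) (by simpa using memLp_const (1 : ℝ))
  rw [← Real.sqrt_eq_rpow, ← Real.sqrt_eq_rpow] at hcs
  simp only [mul_one, Real.rpow_two, sq_abs, one_pow, integral_const, smul_eq_mul,
    MeasurableSet.univ, measureReal_restrict_apply, Set.univ_inter, hvol] at hcs
  calc |∫ u in s..t, h u| = |∫ u in Set.uIoc s t, h u| :=
        intervalIntegral.abs_intervalIntegral_eq _ _ _ _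
    _ ≤ ∫ u in Set.uIoc s t, |h u| := abs_integral_le_integral_abs
    _ ≤ _ := hcs
    _ ≤ _ := by
      gcongr
      · exact ae_of_all _ fun _ ↦ sq_nonneg _
      · exact hh.integrable_sq

section Increment

variable {Ω : Type*} [MeasurableSpace Ω] {P : Measure Ω} [IsProbabilityMeasure P] {W : ℕ → Ω → ℝ}
  {φ φ' : ℝ → ℝ → ℝ} {T C : ℝ}

lemma measurable_centredSum (hφ : Continuous (Function.uncurry φ)) (hW : ∀ j, Measurable (W j))
    (n : ℕ) : Measurable (Function.uncurry (centredSum P W φ n)) := by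
  have h (j : ℕ) : Measurable fun p : ℝ × Ω ↦ φ p.1 (W j p.2) :=
    hφ.measurable.comp (measurable_fst.prodMk ((hW j).comp measurable_snd))
  have hm : Measurable fun p : ℝ × Ω ↦ ∫ ω', φ p.1 (W 0 ω') ∂P :=
    (h 0).stronglyMeasurable.integral_prod_right'.measurable.comp measurable_fst
  exact (Finset.measurable_fun_sum _ fun j _ ↦ (h j).sub hm).const_mul _

lemma memLp_restrict_Icc_of_continuous {h : ℝ → ℝ} (hh : Continuous h) :
    MemLp h 2 (volume.restrict (Set.Icc 0 T)) := by
  obtain ⟨B, hB⟩ := isCompact_Icc.exists_bound_of_continuousOn (hh.continuousOn (s := Set.Icc 0 T))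
  exact MemLp.of_bound hh.aestronglyMeasurable B
    ((ae_restrict_iff' measurableSet_Icc).2 (ae_of_all _ hB))

/-- The mean function inherits square integrability from bounded variances. -/
lemma memLp_integral_of_variance_le (hW : ∀ j, Measurable (W j)) (hindep : iIndepFun W P)
    (hident : ∀ j, IdentDistrib (W j) (W 0) P P) (hφ : Continuous (Function.uncurry φ))
    (hL2 : ∀ u ∈ Set.Icc 0 T, MemLp (fun ω ↦ φ u (W 0 ω)) 2 P)
    (hvar : ∀ u ∈ Set.Icc 0 T, Var[fun ω ↦ φ u (W 0 ω); P] ≤ C) :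
    MemLp (fun u ↦ ∫ ω, φ u (W 0 ω) ∂P) 2 (volume.restrict (Set.Icc 0 T)) := by
  have hφu (u : ℝ) : Measurable (φ u) := (hφ.comp (by fun_prop : Continuous (Prod.mk u))).measurable
  have hmeas := measurable_centredSum (P := P) hφ hW 1
  have hint := integrable_sq_prod_of_bound (ψ := centredSum P W φ 1) hmeas
    (fun u hu ↦ memLp_centredSum hident (hφu u) (hL2 u hu) 1)
    (fun u hu ↦ integral_centredSum_sq_le hindep hident (hφu u) (hL2 u hu) (hvar u hu) 1)
  obtain ⟨ω, hω⟩ := hint.prod_left_ae.exists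
  have h1 : MemLp (fun u ↦ centredSum P W φ 1 u ω) 2 (volume.restrict (Set.Icc 0 T)) :=
    (memLp_two_iff_integrable_sq
      (hmeas.comp measurable_prodMk_right).aestronglyMeasurable).2 hω
  have h2 : MemLp (fun u ↦ φ u (W 0 ω)) 2 (volume.restrict (Set.Icc 0 T)) :=
    memLp_restrict_Icc_of_continuous (hφ.comp (by fun_prop : Continuous fun u : ℝ ↦ (u, W 0 ω)))
  refine (h2.sub h1).congr_norm ?_ (ae_of_all _ fun u ↦ ?_)
  · exact ((hφ.measurable.comp (measurable_fst.prodMk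
      ((hW 0).comp measurable_snd))).stronglyMeasurable.integral_prod_right').aestronglyMeasurable
  · simp [centredSum_one]

lemma memLp_centredSum_path (hW : ∀ j, Measurable (W j)) (hindep : iIndepFun W P)
    (hident : ∀ j, IdentDistrib (W j) (W 0) P P) (hφ : Continuous (Function.uncurry φ))
    (hL2 : ∀ u ∈ Set.Icc 0 T, MemLp (fun ω ↦ φ u (W 0 ω)) 2 P)
    (hvar : ∀ u ∈ Set.Icc 0 T, Var[fun ω ↦ φ u (W 0 ω); P] ≤ C) (n : ℕ) (ω : Ω) :
    MemLp (fun u ↦ centredSum P W φ n u ω) 2 (volume.restrict (Set.Icc 0 T)) :=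
  (memLp_finsetSum _ fun j _ ↦ (memLp_restrict_Icc_of_continuous
    (hφ.comp (by fun_prop : Continuous fun u : ℝ ↦ (u, W j ω)))).sub
      (memLp_integral_of_variance_le hW hindep hident hφ hL2 hvar)).const_mul _

lemma integral_sub_integral_eq_intervalIntegral (hW : ∀ j, Measurable (W j))
    (hindep : iIndepFun W P) (hident : ∀ j, IdentDistrib (W j) (W 0) P P)
    (hφ' : Continuous (Function.uncurry φ'))
    (hderiv : ∀ u w, HasDerivAt (fun u ↦ φ u w) (φ' u w) u)
    (hint : ∀ u ∈ Set.Icc 0 T, Integrable (fun ω ↦ φ u (W 0 ω)) P)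
    (hL2 : ∀ u ∈ Set.Icc 0 T, MemLp (fun ω ↦ φ' u (W 0 ω)) 2 P)
    (hvar : ∀ u ∈ Set.Icc 0 T, Var[fun ω ↦ φ' u (W 0 ω); P] ≤ C)
    {s t : ℝ} (hs : s ∈ Set.Icc 0 T) (ht : t ∈ Set.Icc 0 T) :
    ∫ ω, φ t (W 0 ω) ∂P - ∫ ω, φ s (W 0 ω) ∂P = ∫ u in s..t, ∫ ω, φ' u (W 0 ω) ∂P := by
  have hφu (u : ℝ) : Measurable (φ' u) :=
    (hφ'.comp (by fun_prop : Continuous (Prod.mk u))).measurable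
  have hmeas := measurable_centredSum (P := P) hφ' hW 1
  have hsq := integrable_sq_prod_of_bound (ψ := centredSum P W φ' 1) hmeas
    (fun u hu ↦ memLp_centredSum hident (hφu u) (hL2 u hu) 1)
    (fun u hu ↦ integral_centredSum_sq_le hindep hident (hφu u) (hL2 u hu) (hvar u hu) 1)
  have h1 : Integrable (Function.uncurry (centredSum P W φ' 1))
      ((volume.restrict (Set.Icc 0 T)).prod P) :=
    ((memLp_two_iff_integrable_sq hmeas.aestronglyMeasurable).2 hsq).integrable one_le_two
  have h2 : Integrable (fun p : ℝ × Ω ↦ ∫ ω, φ' p.1 (W 0 ω) ∂P)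
      ((volume.restrict (Set.Icc 0 T)).prod P) :=
    ((memLp_integral_of_variance_le hW hindep hident hφ' hL2 hvar).integrable one_le_two).comp_fst P
  have h3 : Integrable (fun p : ℝ × Ω ↦ φ' p.1 (W 0 p.2))
      ((volume.restrict (Set.Icc 0 T)).prod P) := by
    refine (h1.add h2).congr (ae_of_all _ fun p ↦ ?_)
    simp [Function.uncurry, centredSum_one]
  have hsub : Set.uIoc s t ⊆ Set.Icc 0 T :=
    Set.uIoc_subset_uIcc.trans (Set.ordConnected_Icc.uIcc_subset hs ht)
  have hftc (w : ℝ) : φ t w - φ s w = ∫ u in s..t, φ' u w :=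
    (intervalIntegral.integral_eq_sub_of_hasDerivAt (fun u _ ↦ hderiv u w)
      ((hφ'.comp (by fun_prop : Continuous fun u : ℝ ↦ (u, w))).intervalIntegrable _ _)).symm
  rw [← integral_sub (hint t ht) (hint s hs)]
  simp_rw [hftc]
  exact (intervalIntegral_integral_swap (f := fun u ω ↦ φ' u (W 0 ω)) (h3.mono_measure
    (Measure.prod_mono (Measure.restrict_mono_set _ hsub) le_rfl))).symm

lemma centredSum_sub_centredSum (hW : ∀ j, Measurable (W j))
    (hindep : iIndepFun W P) (hident : ∀ j, IdentDistrib (W j) (W 0) P P)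
    (hφ' : Continuous (Function.uncurry φ'))
    (hderiv : ∀ u w, HasDerivAt (fun u ↦ φ u w) (φ' u w) u)
    (hint : ∀ u ∈ Set.Icc 0 T, Integrable (fun ω ↦ φ u (W 0 ω)) P)
    (hL2 : ∀ u ∈ Set.Icc 0 T, MemLp (fun ω ↦ φ' u (W 0 ω)) 2 P)
    (hvar : ∀ u ∈ Set.Icc 0 T, Var[fun ω ↦ φ' u (W 0 ω); P] ≤ C)
    {s t : ℝ} (hs : s ∈ Set.Icc 0 T) (ht : t ∈ Set.Icc 0 T) (n : ℕ) (ω : Ω) :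
    centredSum P W φ n t ω - centredSum P W φ n s ω = ∫ u in s..t, centredSum P W φ' n u ω := by
  have hsub : Set.uIoc s t ⊆ Set.Icc 0 T :=
    Set.uIoc_subset_uIcc.trans (Set.ordConnected_Icc.uIcc_subset hs ht)
  have hm : IntervalIntegrable (fun u ↦ ∫ ω, φ' u (W 0 ω) ∂P) volume s t :=
    intervalIntegrable_iff.2 (((memLp_integral_of_variance_le hW hindep hident hφ' hL2
      hvar).integrable one_le_two).mono_measure (Measure.restrict_mono_set _ hsub))
  have hc (w : ℝ) : IntervalIntegrable (fun u ↦ φ' u w) volume s t :=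
    (hφ'.comp (by fun_prop : Continuous fun u : ℝ ↦ (u, w))).intervalIntegrable _ _
  have hftc (w : ℝ) : φ t w - φ s w = ∫ u in s..t, φ' u w :=
    (intervalIntegral.integral_eq_sub_of_hasDerivAt (fun u _ ↦ hderiv u w) (hc w)).symm
  simp only [centredSum]
  rw [intervalIntegral.integral_const_mul, intervalIntegral.integral_finsetSum
    fun j _ ↦ (hc _).sub hm, ← mul_sub, ← Finset.sum_sub_distrib]
  congr 1
  refine Finset.sum_congr rfl fun j _ ↦ ?_
  rw [intervalIntegral.integral_sub (hc _) hm, ← hftc,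
    ← integral_sub_integral_eq_intervalIntegral hW hindep hident hφ' hderiv hint hL2 hvar hs ht]
  ring

end Increment

section Energy

variable {Ω : Type*} [MeasurableSpace Ω] {P : Measure Ω} [IsProbabilityMeasure P] {W : ℕ → Ω → ℝ}
  {φ φ' : ℝ → ℝ → ℝ} {T C : ℝ}

/-- The squared Sobolev norm of the path `u ↦ centredSum P W φ n u ω` on `[0, T]`, where `φ'` is the
derivative of `φ`. -/
noncomputable def pathEnergy (P : Measure Ω) (W : ℕ → Ω → ℝ) (φ φ' : ℝ → ℝ → ℝ) (T : ℝ) (n : ℕ)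
    (ω : Ω) : ℝ :=
  centredSum P W φ n 0 ω ^ 2 + ∫ u in Set.Icc 0 T, centredSum P W φ' n u ω ^ 2

lemma pathEnergy_nonneg {P : Measure Ω} (n : ℕ) (ω : Ω) : 0 ≤ pathEnergy P W φ φ' T n ω :=
  add_nonneg (sq_nonneg _) (integral_nonneg fun _ ↦ sq_nonneg _)

lemma integrable_pathEnergy_and_integral_le (hT : 0 ≤ T) (hW : ∀ j, Measurable (W j))
    (hindep : iIndepFun W P) (hident : ∀ j, IdentDistrib (W j) (W 0) P P)
    (hφ : Continuous (Function.uncurry φ)) (hφ' : Continuous (Function.uncurry φ'))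
    (hL2 : MemLp (fun ω ↦ φ 0 (W 0 ω)) 2 P) (hvar : Var[fun ω ↦ φ 0 (W 0 ω); P] ≤ C)
    (hL2' : ∀ u ∈ Set.Icc 0 T, MemLp (fun ω ↦ φ' u (W 0 ω)) 2 P)
    (hvar' : ∀ u ∈ Set.Icc 0 T, Var[fun ω ↦ φ' u (W 0 ω); P] ≤ C) (n : ℕ) :
    Integrable (pathEnergy P W φ φ' T n) P ∧ ∫ ω, pathEnergy P W φ φ' T n ω ∂P ≤ C + T * C := by
  have hφ0 : Measurable (φ 0) := (hφ.comp (by fun_prop : Continuous (Prod.mk (0 : ℝ)))).measurable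
  have hφu (u : ℝ) : Measurable (φ' u) :=
    (hφ'.comp (by fun_prop : Continuous (Prod.mk u))).measurable
  have hmeas := measurable_centredSum (P := P) hφ' hW n
  have hmem := fun u hu ↦ memLp_centredSum hident (hφu u) (hL2' u hu) n
  have hbound := fun u hu ↦
    integral_centredSum_sq_le hindep hident (hφu u) (hL2' u hu) (hvar' u hu) n
  have i1 := (memLp_centredSum hident hφ0 hL2 n).integrable_sq
  have i2 := (integrable_sq_prod_of_bound hmeas hmem hbound).integral_prod_right
  refine ⟨i1.add i2, ?_⟩
  simp only [pathEnergy]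
  rw [integral_add i1 i2]
  exact add_le_add (integral_centredSum_sq_le hindep hident hφ0 hL2 hvar n)
    (integral_integral_sq_le hT hmeas hmem hbound)

lemma abs_centredSum_sub_le (hW : ∀ j, Measurable (W j))
    (hindep : iIndepFun W P) (hident : ∀ j, IdentDistrib (W j) (W 0) P P)
    (hφ' : Continuous (Function.uncurry φ'))
    (hderiv : ∀ u w, HasDerivAt (fun u ↦ φ u w) (φ' u w) u)
    (hint : ∀ u ∈ Set.Icc 0 T, Integrable (fun ω ↦ φ u (W 0 ω)) P)
    (hL2 : ∀ u ∈ Set.Icc 0 T, MemLp (fun ω ↦ φ' u (W 0 ω)) 2 P)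
    (hvar : ∀ u ∈ Set.Icc 0 T, Var[fun ω ↦ φ' u (W 0 ω); P] ≤ C)
    {s t : ℝ} (hs : s ∈ Set.Icc 0 T) (ht : t ∈ Set.Icc 0 T) (n : ℕ) (ω : Ω) :
    |centredSum P W φ n t ω - centredSum P W φ n s ω| ≤
      √(pathEnergy P W φ φ' T n ω) * √|t - s| := by
  rw [centredSum_sub_centredSum hW hindep hident hφ' hderiv hint hL2 hvar hs ht]
  refine (abs_intervalIntegral_le_sqrt_mul_sqrt
    (memLp_centredSum_path hW hindep hident hφ' hL2 hvar n ω) hs ht).trans ?_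
  gcongr
  exact le_add_of_nonneg_left (sq_nonneg _)

lemma abs_centredSum_le (hT : 0 ≤ T) (hW : ∀ j, Measurable (W j))
    (hindep : iIndepFun W P) (hident : ∀ j, IdentDistrib (W j) (W 0) P P)
    (hφ' : Continuous (Function.uncurry φ'))
    (hderiv : ∀ u w, HasDerivAt (fun u ↦ φ u w) (φ' u w) u)
    (hint : ∀ u ∈ Set.Icc 0 T, Integrable (fun ω ↦ φ u (W 0 ω)) P)
    (hL2 : ∀ u ∈ Set.Icc 0 T, MemLp (fun ω ↦ φ' u (W 0 ω)) 2 P)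
    (hvar : ∀ u ∈ Set.Icc 0 T, Var[fun ω ↦ φ' u (W 0 ω); P] ≤ C)
    {t : ℝ} (ht : t ∈ Set.Icc 0 T) (n : ℕ) (ω : Ω) :
    |centredSum P W φ n t ω| ≤ √(pathEnergy P W φ φ' T n ω) * (1 + √T) := by
  have h1 := abs_centredSum_sub_le hW hindep hident hφ' hderiv hint hL2 hvar
    (Set.left_mem_Icc.2 hT) ht n ω
  have h2 : |centredSum P W φ n 0 ω| ≤ √(pathEnergy P W φ φ' T n ω) :=
    Real.abs_le_sqrt (le_add_of_nonneg_right (integral_nonneg fun _ ↦ sq_nonneg _))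
  have h3 : √(pathEnergy P W φ φ' T n ω) * √|t - 0| ≤ √(pathEnergy P W φ φ' T n ω) * √T := by
    rw [sub_zero, abs_of_nonneg ht.1]
    gcongr
    exact ht.2
  have h4 := abs_sub_abs_le_abs_sub (centredSum P W φ n t ω) (centredSum P W φ n 0 ω)
  linarith

end Energy

lemma norm_R3_le {v : R3} {a : ℝ} (hv : ∀ i, |v i| ≤ a) : ‖v‖ ≤ 2 * a := by
  have ha : 0 ≤ a := (abs_nonneg _).trans (hv 0)
  rw [EuclideanSpace.norm_eq, Real.sqrt_le_left (by positivity)]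
  have h (i : Fin 3) : ‖v i‖ ^ 2 ≤ a ^ 2 := by
    rw [Real.norm_eq_abs]
    exact pow_le_pow_left₀ (abs_nonneg _) (hv i) 2
  calc ∑ i, ‖v i‖ ^ 2 ≤ ∑ _ : Fin 3, a ^ 2 := Finset.sum_le_sum fun i _ ↦ h i
    _ ≤ (2 * a) ^ 2 := by
      simp only [Finset.sum_const, Finset.card_univ, Fintype.card_fin, nsmul_eq_mul]
      push_cast
      nlinarith [sq_nonneg a]

section Compact

variable {S : Type*} [TopologicalSpace S]

/-- Bounded functions which are `1/2`-Hölder with respect to a continuous time change. -/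
def holderBall (τ : C(S, ℝ)) (a b : ℝ) : Set C(S, R3) :=
  {x | (∀ s i, |x s i| ≤ a) ∧ ∀ s s' i, |x s i - x s' i| ≤ b * √|τ s - τ s'|}

lemma isCompact_holderBall (τ : C(S, ℝ)) (a b : ℝ) : IsCompact (holderBall τ a b) := by
  have hmod (s₀ : S) : Tendsto (fun s ↦ 2 * (b * √|τ s₀ - τ s|)) (𝓝 s₀) (𝓝 0) := by
    have : Continuous fun s ↦ 2 * (b * √|τ s₀ - τ s|) := by fun_prop
    simpa using this.tendsto s₀
  have hdist {x : S → R3} (hx : ∀ s s' i, |x s i - x s' i| ≤ b * √|τ s - τ s'|) (s s' : S) :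
      dist (x s) (x s') ≤ 2 * (b * √|τ s - τ s'|) := by
    rw [dist_eq_norm]
    exact norm_R3_le fun i ↦ by simpa using hx s s' i
  refine ArzelaAscoli.isCompact_of_equicontinuous _ ?_ fun s₀ ↦ ?_
  · have himage : ContinuousMap.toFun '' holderBall τ a b =
        {x : S → R3 | (∀ s i, |x s i| ≤ a) ∧ ∀ s s' i, |x s i - x s' i| ≤ b * √|τ s - τ s'|} := by
      ext x
      constructor
      · rintro ⟨y, hy, rfl⟩
        exact hy
      · intro hx
        refine ⟨⟨x, continuous_iff_continuousAt.2 fun s₀ ↦ ?_⟩, hx, rfl⟩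
        exact tendsto_iff_dist_tendsto_zero.2 <| squeeze_zero (fun _ ↦ dist_nonneg)
          (fun s ↦ (dist_comm (x s) (x s₀)).trans_le (hdist hx.2 s₀ s)) (hmod s₀)
    rw [himage]
    refine (isCompact_univ_pi fun _ : S ↦ isCompact_closedBall (0 : R3) (2 * a)).of_isClosed_subset
      ?_ fun x hx s _ ↦ by simpa using norm_R3_le (hx.1 s)
    have hc (s : S) (i : Fin 3) : Continuous fun x : S → R3 ↦ x s i := by fun_prop
    simp only [Set.ofPred_and, Set.ofPred_forall]
    refine IsClosed.inter (isClosed_iInter fun s ↦ isClosed_iInter fun i ↦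
      isClosed_le (hc s i).abs continuous_const) ?_
    exact isClosed_iInter fun s ↦ isClosed_iInter fun s' ↦ isClosed_iInter fun i ↦
      isClosed_le ((hc s i).sub (hc s' i)).abs continuous_const
  · refine Metric.equicontinuousAt_of_continuity_modulus _ (hmod s₀) _ ?_
    exact Eventually.of_forall fun s x ↦ hdist x.2.2 s₀ s

end Compact

/-- Evaluation of a coordinate at a point. -/
noncomputable def evalCoord {S : Type*} [TopologicalSpace S] [CompactSpace S] (s : S) (i : Fin 3) :
    StrongDual ℝ C(S, R3) :=
  (EuclideanSpace.proj i).comp (ContinuousMap.evalCLM ℝ s)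

@[simp]
lemma evalCoord_apply {S : Type*} [TopologicalSpace S] [CompactSpace S] (s : S) (i : Fin 3)
    (x : C(S, R3)) : evalCoord s i x = x s i := rfl

section FamilyCLT

variable {Ω : Type*} [MeasurableSpace Ω] {P : Measure Ω} {W : ℕ → Ω → ℝ}
  {φ : ℕ → ℝ → ℝ → ℝ} {T C : ℝ} {S : Type*} [TopologicalSpace S] {τ : C(S, ℝ)}

/-- The centred triple `(φ₀, φ₁, φ₂)` at the time `τ(s)` as a continuous function of the parameter
`w` with values in `C(S, ℝ³)`. -/
noncomputable def centredTriple (m : ℕ → C(ℝ, ℝ)) (φ : ℕ → ℝ → ℝ → ℝ)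
    (hφ : ∀ k, Continuous (Function.uncurry (φ k))) (τ : C(S, ℝ)) : C(ℝ, C(S, R3)) :=
  ContinuousMap.curry ⟨fun p ↦ WithLp.toLp 2 fun i : Fin 3 ↦ φ i (τ p.2) p.1 - m i (τ p.2), by
    refine (PiLp.continuous_toLp 2 _).comp (continuous_pi fun i ↦ ?_)
    exact ((hφ i).comp (by fun_prop : Continuous fun p : ℝ × S ↦ (τ p.2, p.1))).sub (by fun_prop)⟩

lemma normalizedSum_centredTriple_apply {m : ℕ → C(ℝ, ℝ)}
    (hm : ∀ k ≤ 2, ∀ u, m k u = ∫ ω, φ k u (W 0 ω) ∂P)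
    (hφ : ∀ k, Continuous (Function.uncurry (φ k))) (n : ℕ) (ω : Ω) (s : S) (i : Fin 3) :
    normalizedSum (fun j ω ↦ centredTriple m φ hφ τ (W j ω)) n ω s i =
      centredSum P W (φ i) n (τ s) ω := by
  have h2 : (i : ℕ) ≤ 2 := by omega
  simp [normalizedSum, centredSum, centredTriple, hm i h2]

/-- **Central limit theorem for smooth families.** Let `φ₀, φ₁, φ₂, φ₃` be successive derivatives
in `u` with bounded variances on `[0, T]`. Then the normalized centred sums of `(φ₀, φ₁, φ₂)`
converge in distribution in the space of continuous functions to a centred Gaussian process. -/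
theorem exists_tendstoInDistribution_centredSum [IsProbabilityMeasure P] [CompactSpace S] [T2Space S]
    [SecondCountableTopology S]
    (hT : 0 ≤ T) (hW : ∀ j, Measurable (W j)) (hindep : iIndepFun W P)
    (hident : ∀ j, IdentDistrib (W j) (W 0) P P)
    (hφ : ∀ k, Continuous (Function.uncurry (φ k)))
    (hderiv : ∀ k u w, HasDerivAt (fun u ↦ φ k u w) (φ (k + 1) u w) u)
    (hL2 : ∀ k ≤ 3, ∀ u ∈ Set.Icc 0 T, MemLp (fun ω ↦ φ k u (W 0 ω)) 2 P)
    (hvar : ∀ k ≤ 3, ∀ u ∈ Set.Icc 0 T, Var[fun ω ↦ φ k u (W 0 ω); P] ≤ C)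
    (hmean : ∀ k ≤ 2, Continuous fun u ↦ ∫ ω, φ k u (W 0 ω) ∂P)
    (hτ : ∀ s, τ s ∈ Set.Icc 0 T) :
    ∃ Y : ℕ → Ω → C(S, R3),
      (∀ n ω s (i : Fin 3), Y n ω s i = centredSum P W (φ i) n (τ s) ω) ∧
      ∃ μ : ProbabilityMeasure C(S, R3),
        TendstoInDistribution Y atTop (id : C(S, R3) → C(S, R3)) (fun _ ↦ P) (μ : Measure _) ∧
        IsGaussianProcess (fun (s : S) (x : C(S, R3)) ↦ x s) (μ : Measure C(S, R3)) ∧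
        (∀ (s : S) (i : Fin 3), ∫ x : C(S, R3), x s i ∂(μ : Measure _) = 0) ∧
        ∀ (s s' : S) (i k : Fin 3),
          cov[fun x : C(S, R3) ↦ x s i, fun x : C(S, R3) ↦ x s' k; (μ : Measure _)] =
          cov[fun ω ↦ φ i (τ s) (W 0 ω), fun ω ↦ φ k (τ s') (W 0 ω); P] := by
  let m : ℕ → C(ℝ, ℝ) := fun k ↦
    if hk : k ≤ 2 then ⟨fun u ↦ ∫ ω, φ k u (W 0 ω) ∂P, hmean k hk⟩ else 0
  have hm (k : ℕ) (hk : k ≤ 2) (u : ℝ) : m k u = ∫ ω, φ k u (W 0 ω) ∂P := by simp [m, hk]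
  let V : C(ℝ, C(S, R3)) := centredTriple m φ hφ τ
  let X : ℕ → Ω → C(S, R3) := fun j ω ↦ V (W j ω)
  have hX (j : ℕ) : Measurable (X j) := V.continuous.measurable.comp (hW j)
  have hXindep : iIndepFun X P := hindep.comp (fun _ ↦ V) fun _ ↦ V.continuous.measurable
  have hXident (j : ℕ) : IdentDistrib (X j) (X 0) P P := (hident j).comp V.continuous.measurable
  have hY (n : ℕ) (ω : Ω) (s : S) (i : Fin 3) :
      normalizedSum X n ω s i = centredSum P W (φ i) n (τ s) ω :=
    normalizedSum_centredTriple_apply hm hφ n ω s i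
  have hX0 (ω : Ω) : X 0 ω = normalizedSum X 1 ω := by simp [normalizedSum]
  let A : ℕ → Ω → ℝ := fun n ω ↦ ∑ i : Fin 3, pathEnergy P W (φ i) (φ (i + 1)) T n ω
  have hA_le (i : Fin 3) (n : ℕ) (ω : Ω) : pathEnergy P W (φ i) (φ (i + 1)) T n ω ≤ A n ω :=
    Finset.single_le_sum (f := fun i : Fin 3 ↦ pathEnergy P W (φ i) (φ (i + 1)) T n ω)
      (fun _ _ ↦ pathEnergy_nonneg n ω) (Finset.mem_univ i)
  have hA0 (n : ℕ) (ω : Ω) : 0 ≤ A n ω := Finset.sum_nonneg fun _ _ ↦ pathEnergy_nonneg n ω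
  have h0T : (0 : ℝ) ∈ Set.Icc 0 T := Set.left_mem_Icc.2 hT
  have hE (i : Fin 3) (n : ℕ) := integrable_pathEnergy_and_integral_le hT hW hindep hident (hφ i)
    (hφ (i + 1)) (hL2 i (by omega) 0 h0T) (hvar i (by omega) 0 h0T) (hL2 (i + 1) (by omega))
    (hvar (i + 1) (by omega)) n
  have hAint (n : ℕ) : Integrable (A n) P := integrable_finsetSum _ fun i _ ↦ (hE i n).1
  have hAbound (n : ℕ) : ∫ ω, A n ω ∂P ≤ 3 * (C + T * C) := by
    simp only [A]
    rw [integral_finsetSum _ fun i _ ↦ (hE i n).1]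
    exact (Finset.sum_le_sum fun i _ ↦ (hE i n).2).trans_eq (by simp; ring)
  have hYholder (n : ℕ) (ω : Ω) (s s' : S) (i : Fin 3) :
      |normalizedSum X n ω s i - normalizedSum X n ω s' i| ≤ √(A n ω) * √|τ s - τ s'| := by
    rw [hY, hY]
    refine (abs_centredSum_sub_le hW hindep hident (hφ (i + 1)) (hderiv i)
      (fun u hu ↦ (hL2 i (by omega) u hu).integrable one_le_two) (hL2 (i + 1) (by omega))
      (hvar (i + 1) (by omega)) (hτ s') (hτ s) n ω).trans ?_
    gcongr
    exact hA_le i n ω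
  have hYabs (n : ℕ) (ω : Ω) (s : S) (i : Fin 3) :
      |normalizedSum X n ω s i| ≤ √(A n ω) * (1 + √T) := by
    rw [hY]
    refine (abs_centredSum_le hT hW hindep hident (hφ (i + 1)) (hderiv i)
      (fun u hu ↦ (hL2 i (by omega) u hu).integrable one_le_two) (hL2 (i + 1) (by omega))
      (hvar (i + 1) (by omega)) (hτ s) n ω).trans ?_
    gcongr
    exact hA_le i n ω
  have hXmem : MemLp (X 0) 2 P := by
    have hbound : MemLp (fun ω ↦ 2 * (√(A 1 ω) * (1 + √T))) 2 P := by
      refine MemLp.const_mul (MemLp.mul_const ?_ _) _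
      have hmeas := Real.continuous_sqrt.comp_aestronglyMeasurable (hAint 1).1
      refine (memLp_two_iff_integrable_sq hmeas).2 ((hAint 1).congr (ae_of_all _ fun ω ↦ ?_))
      simp [Real.sq_sqrt (hA0 1 ω)]
    refine hbound.mono (hX 0).aestronglyMeasurable (ae_of_all _ fun ω ↦ ?_)
    rw [Real.norm_of_nonneg (by positivity), ContinuousMap.norm_le _ (by positivity)]
    intro s
    refine norm_R3_le fun i ↦ ?_
    rw [hX0]
    exact hYabs 1 ω s i
  have hXint : Integrable (X 0) P := hXmem.integrable one_le_two
  have hLmem (L : StrongDual ℝ C(S, R3)) : MemLp (fun ω ↦ L (X 0 ω)) 2 P :=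
    L.comp_memLp' hXmem
  have hXapply (ω : Ω) (s : S) (i : Fin 3) :
      X 0 ω s i = φ i (τ s) (W 0 ω) - ∫ ω', φ i (τ s) (W 0 ω') ∂P := by
    rw [hX0, hY, centredSum_one]
  have hXzero : ∫ ω, X 0 ω ∂P = 0 := by
    ext s i
    change evalCoord s i (∫ ω, X 0 ω ∂P) = 0
    rw [← ContinuousLinearMap.integral_comp_comm _ hXint]
    simp only [evalCoord_apply, hXapply]
    rw [integral_sub ((hL2 i (by omega) _ (hτ s)).integrable one_le_two) (integrable_const _)]
    simp
  have hLzero (L : StrongDual ℝ C(S, R3)) : ∫ ω, L (X 0 ω) ∂P = 0 := by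
    rw [ContinuousLinearMap.integral_comp_comm _ hXint, hXzero, map_zero]
  have htight : IsTightMeasureSet {ν | ∃ n, P.map (normalizedSum X n) = ν} := by
    rw [isTightMeasureSet_iff_exists_isCompact_measure_compl_le]
    intro ε hε
    rcases eq_or_ne ε ⊤ with rfl | hε'
    · exact ⟨∅, isCompact_empty, fun _ _ ↦ le_top⟩
    have hδ : 0 < ε.toReal := ENNReal.toReal_pos hε.ne' hε'
    have hB : 0 ≤ 3 * (C + T * C) := (integral_nonneg (hA0 0)).trans (hAbound 0)
    set r := (3 * (C + T * C) + 1) / ε.toReal with hr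
    have hr0 : 0 < r := by positivity
    refine ⟨holderBall τ (√r * (1 + √T)) √r, isCompact_holderBall _ _ _, ?_⟩
    rintro _ ⟨n, rfl⟩
    rw [Measure.map_apply (measurable_normalizedSum hX n)
      (isCompact_holderBall _ _ _).isClosed.measurableSet.compl]
    have hsub : normalizedSum X n ⁻¹' (holderBall τ (√r * (1 + √T)) √r)ᶜ ⊆ {ω | r ≤ A n ω} := by
      intro ω hω
      by_contra hlt
      have hle : √(A n ω) ≤ √r := Real.sqrt_le_sqrt (not_le.1 hlt).le
      refine hω ⟨fun s i ↦ (hYabs n ω s i).trans ?_, fun s s' i ↦ (hYholder n ω s s' i).trans ?_⟩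
      · gcongr
      · gcongr
    refine (measure_mono hsub).trans ?_
    have hmarkov := mul_meas_ge_le_integral_of_nonneg (ae_of_all P (hA0 n)) (hAint n) r
    have hreal : P.real {ω | r ≤ A n ω} ≤ ε.toReal := by
      refine le_of_mul_le_mul_left ?_ hr0
      calc r * P.real {ω | r ≤ A n ω} ≤ 3 * (C + T * C) := hmarkov.trans (hAbound n)
        _ ≤ 3 * (C + T * C) + 1 := by linarith
        _ = r * ε.toReal := by rw [hr, div_mul_cancel₀ _ hδ.ne']
    exact (ENNReal.toReal_le_toReal (measure_ne_top _ _) hε').1 hreal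
  obtain ⟨μ, hμ, hlaw⟩ := exists_tendstoInDistribution_normalizedSum hX hXindep hXident hLmem
    hLzero htight
  have hgauss : IsGaussian (μ : Measure C(S, R3)) := isGaussian_of_map_dual hlaw
  refine ⟨normalizedSum X, hY, μ, hμ, ⟨fun I ↦ ?_⟩, fun s i ↦
    integral_dual_eq_zero hlaw (evalCoord s i), fun s s' i k ↦ ?_⟩
  · let R : C(S, R3) →L[ℝ] (I → R3) :=
      ContinuousLinearMap.pi fun s : I ↦ ContinuousMap.evalCLM ℝ (s : S)
    exact ⟨(inferInstance : IsGaussian ((μ : Measure C(S, R3)).map R))⟩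
  · refine (covariance_dual_eq hlaw hLmem (evalCoord s i) (evalCoord s' k)).trans ?_
    simp only [evalCoord_apply, hXapply]
    rw [covariance_sub_const_left, covariance_sub_const_right]
    · exact (hL2 k (by omega) _ (hτ s')).integrable one_le_two
    · exact (hL2 i (by omega) _ (hτ s)).integrable one_le_two

end FamilyCLT

section Inverse

/-- If `h` is continuous and monotone, and its derivative at the chosen preimages of the points of
`[h 0, h T]` is positive, then these preimages are unique. -/
lemma eq_invFun_of_deriv_pos {h : ℝ → ℝ} (hmono : Monotone h) {a t : ℝ} (ht : h t = a)
    (hpos : 0 < deriv h (Function.invFun h a)) : t = Function.invFun h a := by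
  set x := Function.invFun h a with hx
  have hxa : h x = a := Function.invFun_eq ⟨t, ht⟩
  have hd : HasDerivAt h (deriv h x) x := (differentiableAt_of_deriv_ne_zero hpos.ne').hasDerivAt
  rcases lt_trichotomy t x with hlt | heq | hlt
  · have hev : h =ᶠ[𝓝[<] x] fun _ ↦ a := by
      filter_upwards [Ioo_mem_nhdsLT hlt] with y hy
      exact le_antisymm (hxa ▸ hmono hy.2.le) (ht ▸ hmono hy.1.le)
    have h0 : HasDerivWithinAt h 0 (Set.Iio x) x :=
      (hasDerivWithinAt_const x _ a).congr_of_eventuallyEq hev hxa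
    exact absurd ((uniqueDiffWithinAt_Iio x).eq_deriv _ hd.hasDerivWithinAt h0) hpos.ne'
  · exact heq
  · have hev : h =ᶠ[𝓝[>] x] fun _ ↦ a := by
      filter_upwards [Ioo_mem_nhdsGT hlt] with y hy
      exact le_antisymm (ht ▸ hmono hy.2.le) (hxa ▸ hmono hy.1.le)
    have h0 : HasDerivWithinAt h 0 (Set.Ioi x) x :=
      (hasDerivWithinAt_const x _ a).congr_of_eventuallyEq hev hxa
    exact absurd ((uniqueDiffWithinAt_Ioi x).eq_deriv _ hd.hasDerivWithinAt h0) hpos.ne'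

variable {h : ℝ → ℝ} {T : ℝ}

lemma mapsTo_invFun_Icc (hT : 0 ≤ T) (hcont : Continuous h) (hmono : Monotone h)
    (hpos : ∀ a ∈ Set.Icc (h 0) (h T), 0 < deriv h (Function.invFun h a)) {a : ℝ}
    (ha : a ∈ Set.Icc (h 0) (h T)) :
    Function.invFun h a ∈ Set.Icc 0 T ∧ h (Function.invFun h a) = a := by
  obtain ⟨t, ht, hta⟩ := intermediate_value_Icc hT hcont.continuousOn ha
  rw [← eq_invFun_of_deriv_pos hmono hta (hpos a ha)]
  exact ⟨ht, hta⟩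

lemma invFun_apply_of_mem_Icc (hmono : Monotone h)
    (hpos : ∀ a ∈ Set.Icc (h 0) (h T), 0 < deriv h (Function.invFun h a)) {t : ℝ}
    (ht : t ∈ Set.Icc 0 T) : Function.invFun h (h t) = t :=
  (eq_invFun_of_deriv_pos hmono rfl (hpos _ ⟨hmono ht.1, hmono ht.2⟩)).symm

lemma continuousOn_invFun_Icc (hT : 0 ≤ T) (hcont : Continuous h) (hmono : Monotone h)
    (hpos : ∀ a ∈ Set.Icc (h 0) (h T), 0 < deriv h (Function.invFun h a)) :
    ContinuousOn (Function.invFun h) (Set.Icc (h 0) (h T)) := by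
  rw [continuousOn_iff_continuous_domRestrict]
  let F : Set.Icc (h 0) (h T) → Set.Icc 0 T := fun a ↦
    ⟨Function.invFun h a, (mapsTo_invFun_Icc hT hcont hmono hpos a.2).1⟩
  have hF : Monotone F := by
    intro a b hab
    by_contra hlt
    have hle := hmono (not_le.1 hlt : Function.invFun h b < Function.invFun h a).le
    rw [(mapsTo_invFun_Icc hT hcont hmono hpos a.2).2,
      (mapsTo_invFun_Icc hT hcont hmono hpos b.2).2] at hle
    exact hlt (le_of_eq (congrArg F (le_antisymm hab hle)))
  have hsurj : Function.Surjective F := fun t ↦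
    ⟨⟨h t, hmono t.2.1, hmono t.2.2⟩, Subtype.ext (invFun_apply_of_mem_Icc hmono hpos t.2)⟩
  exact continuous_subtype_val.comp (hF.continuous_of_surjective hsurj)

end Inverse

section Scaled

/-- `w^k f^{(k)}(u w)`, the `k`-th derivative in `u` of `f(u w)`. -/
noncomputable def scaledDeriv (f : ℝ → ℝ) (k : ℕ) (u w : ℝ) : ℝ :=
  w ^ k * iteratedDeriv k f (u * w)

variable {f : ℝ → ℝ}

lemma continuous_scaledDeriv (hf : ContDiff ℝ ⊤ f) (k : ℕ) :
    Continuous (Function.uncurry (scaledDeriv f k)) := by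
  have := hf.continuous_iteratedDeriv k le_top
  unfold Function.uncurry scaledDeriv
  fun_prop

lemma hasDerivAt_scaledDeriv (hf : ContDiff ℝ ⊤ f) (k : ℕ) (u w : ℝ) :
    HasDerivAt (fun u ↦ scaledDeriv f k u w) (scaledDeriv f (k + 1) u w) u := by
  have h1 : HasDerivAt (iteratedDeriv k f) (iteratedDeriv (k + 1) f (u * w)) (u * w) := by
    rw [iteratedDeriv_succ]
    exact (hf.differentiable_iteratedDeriv k (by exact_mod_cast WithTop.coe_lt_top _) _).hasDerivAt
  have h2 := (h1.comp u ((hasDerivAt_id u).mul_const w)).const_mul (w ^ k)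
  refine h2.congr_deriv ?_
  simp only [scaledDeriv]
  ring

variable {Ω : Type*} [MeasurableSpace Ω] {P : Measure Ω} {X : Ω → ℝ}

lemma measurable_scaledDeriv (hf : ContDiff ℝ ⊤ f) (hX : Measurable X) (k : ℕ) (u : ℝ) :
    Measurable fun ω ↦ scaledDeriv f k u (X ω) :=
  ((continuous_scaledDeriv hf k).comp (by fun_prop : Continuous (Prod.mk u))).measurable.comp hX

lemma scaledDeriv_two_nonneg (hconv : ∀ t, 0 ≤ iteratedDeriv 2 f t) (u w : ℝ) :
    0 ≤ scaledDeriv f 2 u w := mul_nonneg (sq_nonneg _) (hconv _)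

lemma hasDerivAt_integral_scaledDeriv_zero (hf : ContDiff ℝ ⊤ f) (hX : Measurable X)
    (hconv : ∀ t, 0 ≤ iteratedDeriv 2 f t)
    (h0 : ∀ t, Integrable (fun ω ↦ scaledDeriv f 0 t (X ω)) P)
    (h1 : ∀ t, Integrable (fun ω ↦ scaledDeriv f 1 t (X ω)) P) (t : ℝ) :
    HasDerivAt (fun t ↦ ∫ ω, scaledDeriv f 0 t (X ω) ∂P) (∫ ω, scaledDeriv f 1 t (X ω) ∂P) t := by
  have hmono (w : ℝ) : Monotone fun u ↦ scaledDeriv f 1 u w :=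
    monotone_of_hasDerivAt_nonneg (fun u ↦ hasDerivAt_scaledDeriv hf 1 u w)
      (fun u ↦ scaledDeriv_two_nonneg hconv u w)
  refine (hasDerivAt_integral_of_dominated_loc_of_deriv_le
    (F := fun t ω ↦ scaledDeriv f 0 t (X ω)) (F' := fun t ω ↦ scaledDeriv f 1 t (X ω))
    (bound := fun ω ↦ |scaledDeriv f 1 (t - 1) (X ω)| + |scaledDeriv f 1 (t + 1) (X ω)|)
    (Icc_mem_nhds (sub_one_lt t) (lt_add_one t))
    (Eventually.of_forall fun u ↦ (measurable_scaledDeriv hf hX 0 u).aestronglyMeasurable) (h0 t)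
    (measurable_scaledDeriv hf hX 1 t).aestronglyMeasurable (ae_of_all _ fun ω u hu ↦ ?_)
    ((h1 _).abs.add (h1 _).abs)
    (ae_of_all _ fun ω u _ ↦ hasDerivAt_scaledDeriv hf 0 u (X ω))).2
  rw [Real.norm_eq_abs]
  refine (abs_le_max_abs_abs (hmono (X ω) hu.1) (hmono (X ω) hu.2)).trans ?_
  exact max_le_add_of_nonneg (abs_nonneg _) (abs_nonneg _)

lemma ae_forall_scaledDeriv_two_le (hf : ContDiff ℝ ⊤ f) {B : Ω → ℝ}
    (hB : ∀ t, ∀ᵐ ω ∂P, scaledDeriv f 2 t (X ω) ≤ B ω) :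
    ∀ᵐ ω ∂P, ∀ t, scaledDeriv f 2 t (X ω) ≤ B ω := by
  obtain ⟨D, hDc, hDd⟩ := TopologicalSpace.exists_countable_dense ℝ
  filter_upwards [(ae_ball_iff hDc).2 fun t _ ↦ hB t] with ω hω t
  have hcl : IsClosed {t | scaledDeriv f 2 t (X ω) ≤ B ω} :=
    isClosed_le ((continuous_scaledDeriv hf 2).comp
      (by fun_prop : Continuous fun t : ℝ ↦ (t, X ω))) continuous_const
  exact hcl.closure_subset_iff.2 hω (hDd t)

lemma hasDerivAt_integral_scaledDeriv_one (hf : ContDiff ℝ ⊤ f) (hX : Measurable X)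
    (hconv : ∀ t, 0 ≤ iteratedDeriv 2 f t)
    (h1 : ∀ t, Integrable (fun ω ↦ scaledDeriv f 1 t (X ω)) P) {B : Ω → ℝ} (hBint : Integrable B P)
    (hB : ∀ t, ∀ᵐ ω ∂P, scaledDeriv f 2 t (X ω) ≤ B ω) (t : ℝ) :
    HasDerivAt (fun t ↦ ∫ ω, scaledDeriv f 1 t (X ω) ∂P) (∫ ω, scaledDeriv f 2 t (X ω) ∂P) t := by
  refine (hasDerivAt_integral_of_dominated_loc_of_deriv_le
    (F := fun t ω ↦ scaledDeriv f 1 t (X ω)) (F' := fun t ω ↦ scaledDeriv f 2 t (X ω))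
    (bound := B) univ_mem
    (Eventually.of_forall fun u ↦ (measurable_scaledDeriv hf hX 1 u).aestronglyMeasurable) (h1 t)
    (measurable_scaledDeriv hf hX 2 t).aestronglyMeasurable ?_ hBint
    (ae_of_all _ fun ω u _ ↦ hasDerivAt_scaledDeriv hf 1 u (X ω))).2
  filter_upwards [ae_forall_scaledDeriv_two_le hf hB] with ω hω u _
  rw [Real.norm_of_nonneg (scaledDeriv_two_nonneg hconv _ _)]
  exact hω u

lemma continuous_integral_scaledDeriv_two (hf : ContDiff ℝ ⊤ f) (hX : Measurable X)
    (hconv : ∀ t, 0 ≤ iteratedDeriv 2 f t) {B : Ω → ℝ} (hBint : Integrable B P)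
    (hB : ∀ t, ∀ᵐ ω ∂P, scaledDeriv f 2 t (X ω) ≤ B ω) :
    Continuous fun t ↦ ∫ ω, scaledDeriv f 2 t (X ω) ∂P := by
  refine continuous_of_dominated
    (fun u ↦ (measurable_scaledDeriv hf hX 2 u).aestronglyMeasurable) (fun t ↦ ?_) hBint
    (ae_of_all _ fun ω ↦ (continuous_scaledDeriv hf 2).comp
      (by fun_prop : Continuous fun t : ℝ ↦ (t, X ω)))
  filter_upwards [hB t] with ω hω
  rwa [Real.norm_of_nonneg (scaledDeriv_two_nonneg hconv _ _)]

end Scaled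

lemma hasDerivAt_centredSum {Ω : Type*} [MeasurableSpace Ω] {P : Measure Ω} {W : ℕ → Ω → ℝ}
    {φ φ' : ℝ → ℝ → ℝ} (hderiv : ∀ u w, HasDerivAt (fun u ↦ φ u w) (φ' u w) u) {t : ℝ}
    (hmean : HasDerivAt (fun t ↦ ∫ ω, φ t (W 0 ω) ∂P) (∫ ω, φ' t (W 0 ω) ∂P) t) (n : ℕ) (ω : Ω) :
    HasDerivAt (fun t ↦ centredSum P W φ n t ω) (centredSum P W φ' n t ω) t :=
  (HasDerivAt.fun_sum fun j _ ↦ (hderiv t (W j ω)).sub hmean).const_mul _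

section Model

variable {Ω : Type*} [MeasurableSpace Ω] {P : Measure Ω} {W Z : ℕ → Ω → ℝ}

lemma meanLogMgf_eq :
    meanLogMgf P W Z = fun t ↦ ∫ ω, scaledDeriv (logMgf P Z) 0 t (W 0 ω) ∂P := by
  ext t
  simp [meanLogMgf, scaledDeriv, mul_comm]

namespace StandingAssumptions

lemma mem_interior_integrableExpSet (hWZ : StandingAssumptions P W Z)
    (t : ℝ) : t ∈ interior (integrableExpSet (Z 0) P) := by
  have : integrableExpSet (Z 0) P = Set.univ := Set.eq_univ_of_forall hWZ.mgf_finite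
  simp [this]

lemma contDiff_logMgf [IsProbabilityMeasure P] (hWZ : StandingAssumptions P W Z)
    : ContDiff ℝ ⊤ (logMgf P Z) :=
  contDiff_iff_contDiffAt.2 fun t ↦
    (analyticAt_cgf (hWZ.mem_interior_integrableExpSet t)).contDiffAt

lemma iteratedDeriv_two_logMgf_nonneg [IsProbabilityMeasure P] (hWZ : StandingAssumptions P W Z)
    (t : ℝ) : 0 ≤ iteratedDeriv 2 (logMgf P Z) t := by
  rw [logMgf, iteratedDeriv_two_cgf_eq_integral (hWZ.mem_interior_integrableExpSet t)]
  exact div_nonneg (integral_nonneg fun _ ↦ by positivity) mgf_nonneg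

lemma integrable_scaledDeriv_zero (hWZ : StandingAssumptions P W Z) (t : ℝ) :
    Integrable (fun ω ↦ scaledDeriv (logMgf P Z) 0 t (W 0 ω)) P := by
  simpa [scaledDeriv] using hWZ.integrable_f t

lemma integrable_scaledDeriv_one (hWZ : StandingAssumptions P W Z) (t : ℝ) :
    Integrable (fun ω ↦ scaledDeriv (logMgf P Z) 1 t (W 0 ω)) P := by
  simpa [scaledDeriv] using hWZ.integrable_f' t

lemma deriv_meanLogMgf [IsProbabilityMeasure P] (hWZ : StandingAssumptions P W Z) :
    deriv (meanLogMgf P W Z) = fun t ↦ ∫ ω, scaledDeriv (logMgf P Z) 1 t (W 0 ω) ∂P := by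
  ext t
  rw [meanLogMgf_eq]
  exact (hasDerivAt_integral_scaledDeriv_zero hWZ.contDiff_logMgf (hWZ.measurable_W 0)
    hWZ.iteratedDeriv_two_logMgf_nonneg hWZ.integrable_scaledDeriv_zero
    hWZ.integrable_scaledDeriv_one t).deriv

lemma hasDerivAt_deriv_meanLogMgf [IsProbabilityMeasure P] (hWZ : StandingAssumptions P W Z)
    (t : ℝ) :
    HasDerivAt (deriv (meanLogMgf P W Z)) (∫ ω, scaledDeriv (logMgf P Z) 2 t (W 0 ω) ∂P) t := by
  obtain ⟨F, hF, hle⟩ := hWZ.majorant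
  rw [hWZ.deriv_meanLogMgf]
  exact hasDerivAt_integral_scaledDeriv_one hWZ.contDiff_logMgf (hWZ.measurable_W 0)
    hWZ.iteratedDeriv_two_logMgf_nonneg hWZ.integrable_scaledDeriv_one hF hle t

lemma hasDerivAt_mean [IsProbabilityMeasure P] (hWZ : StandingAssumptions P W Z)
    (k : ℕ) (hk : k ≤ 1) (t : ℝ) :
    HasDerivAt (fun t ↦ ∫ ω, scaledDeriv (logMgf P Z) k t (W 0 ω) ∂P)
      (∫ ω, scaledDeriv (logMgf P Z) (k + 1) t (W 0 ω) ∂P) t := by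
  obtain rfl | rfl : k = 0 ∨ k = 1 := by omega
  · exact hasDerivAt_integral_scaledDeriv_zero hWZ.contDiff_logMgf (hWZ.measurable_W 0)
      hWZ.iteratedDeriv_two_logMgf_nonneg hWZ.integrable_scaledDeriv_zero
      hWZ.integrable_scaledDeriv_one t
  · rw [← hWZ.deriv_meanLogMgf]
    exact hWZ.hasDerivAt_deriv_meanLogMgf t

lemma continuous_mean [IsProbabilityMeasure P] (hWZ : StandingAssumptions P W Z)
    (k : ℕ) (hk : k ≤ 2) :
    Continuous fun t ↦ ∫ ω, scaledDeriv (logMgf P Z) k t (W 0 ω) ∂P := by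
  obtain hk' | rfl : k ≤ 1 ∨ k = 2 := by omega
  · exact continuous_iff_continuousAt.2 fun t ↦ (hWZ.hasDerivAt_mean k hk' t).continuousAt
  · obtain ⟨F, hF, hle⟩ := hWZ.majorant
    exact continuous_integral_scaledDeriv_two hWZ.contDiff_logMgf (hWZ.measurable_W 0)
      hWZ.iteratedDeriv_two_logMgf_nonneg hF hle

lemma continuous_deriv_meanLogMgf [IsProbabilityMeasure P] (hWZ : StandingAssumptions P W Z)
    : Continuous (deriv (meanLogMgf P W Z)) :=
  continuous_iff_continuousAt.2 fun t ↦ (hWZ.hasDerivAt_deriv_meanLogMgf t).continuousAt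

lemma monotone_deriv_meanLogMgf [IsProbabilityMeasure P] (hWZ : StandingAssumptions P W Z)
    : Monotone (deriv (meanLogMgf P W Z)) :=
  monotone_of_hasDerivAt_nonneg hWZ.hasDerivAt_deriv_meanLogMgf fun _ ↦
    integral_nonneg fun _ ↦ scaledDeriv_two_nonneg hWZ.iteratedDeriv_two_logMgf_nonneg _ _

lemma intervalJ_eq [IsProbabilityMeasure P] (hWZ : StandingAssumptions P W Z)
    (tstar : ℝ) : intervalJ P W Z tstar =
    Set.Ioo (deriv (meanLogMgf P W Z) 0) (deriv (meanLogMgf P W Z) tstar) := by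
  have h0 : deriv (logMgf P Z) 0 = ∫ ω, Z 0 ω ∂P := by
    rw [logMgf, deriv_cgf_zero (hWZ.mem_interior_integrableExpSet 0)]
    simp
  rw [intervalJ, hWZ.deriv_meanLogMgf]
  simp [scaledDeriv, integral_mul_const, h0]

lemma fluctuation_eq [IsProbabilityMeasure P] (hWZ : StandingAssumptions P W Z) (n : ℕ) (ω : Ω) :
    fluctuation P W Z n ω = fun t ↦ centredSum P W (scaledDeriv (logMgf P Z) 0) n t ω := by
  ext t
  have hmeas : Measurable fun w ↦ logMgf P Z (w * t) :=
    (hWZ.contDiff_logMgf.continuous.comp (by fun_prop)).measurable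
  have hmean (j : ℕ) :
      ∫ ω, logMgf P Z (W j ω * t) ∂P = ∫ ω, logMgf P Z (W 0 ω * t) ∂P :=
    ((hWZ.identDistrib_W j).comp hmeas).integral_eq
  simp [fluctuation, centredSum, scaledDeriv, hmean, mul_comm t]

lemma deriv_fluctuation [IsProbabilityMeasure P] (hWZ : StandingAssumptions P W Z)
    (n : ℕ) (ω : Ω) : deriv (fluctuation P W Z n ω) =
    fun t ↦ centredSum P W (scaledDeriv (logMgf P Z) 1) n t ω := by
  ext t
  rw [hWZ.fluctuation_eq]
  exact (hasDerivAt_centredSum (hasDerivAt_scaledDeriv hWZ.contDiff_logMgf 0)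
    (hWZ.hasDerivAt_mean 0 zero_le_one t) n ω).deriv

lemma iteratedDeriv_two_fluctuation [IsProbabilityMeasure P] (hWZ : StandingAssumptions P W Z)
    (n : ℕ) (ω : Ω) : iteratedDeriv 2 (fluctuation P W Z n ω) =
    fun t ↦ centredSum P W (scaledDeriv (logMgf P Z) 2) n t ω := by
  ext t
  rw [iteratedDeriv_succ, iteratedDeriv_one, hWZ.deriv_fluctuation]
  exact (hasDerivAt_centredSum (hasDerivAt_scaledDeriv hWZ.contDiff_logMgf 1)
    (hWZ.hasDerivAt_mean 1 le_rfl t) n ω).deriv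

lemma tripleProcess_apply [IsProbabilityMeasure P] (hWZ : StandingAssumptions P W Z)
    (n : ℕ) (ω : Ω) (a : ℝ) (i : Fin 3) :
    tripleProcess P W Z n ω a i =
      centredSum P W (scaledDeriv (logMgf P Z) i) n (tilt P W Z a) ω := by
  fin_cases i
  · simp [tripleProcess, hWZ.fluctuation_eq]
  · simp [tripleProcess, hWZ.deriv_fluctuation]
  · simp [tripleProcess, hWZ.iteratedDeriv_two_fluctuation]

end StandingAssumptions

end Model

theorem lemma3 {Ω : Type*} [MeasurableSpace Ω] (P : Measure Ω) [IsProbabilityMeasure P]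
    (W Z : ℕ → Ω → ℝ) (hWZ : StandingAssumptions P W Z)
    (tstar : ℝ) (htstar : 0 < tstar)
    (hg : ∃ c : ℝ, 0 < c ∧ ∀ a ∈ closureJ P W Z tstar,
      c < iteratedDeriv 2 (meanLogMgf P W Z) (tilt P W Z a))
    (hcov : CovAssumption P W Z tstar) :
    -- the triple processes are random elements `Y n` of `C(J̄, ℝ³)`
    ∃ Y : ℕ → Ω → C(closureJ P W Z tstar, R3),
      (∀ n ω a, Y n ω a = tripleProcess P W Z n ω a) ∧
      -- which converge in law to a probability measure `μ` on `C(J̄, ℝ³)`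
      ∃ μ : ProbabilityMeasure C(closureJ P W Z tstar, R3),
        TendstoInDistribution Y atTop
          (id : C(closureJ P W Z tstar, R3) → C(closureJ P W Z tstar, R3))
          (fun _ => P) (μ : Measure C(closureJ P W Z tstar, R3)) ∧
        -- under which the coordinate process is Gaussian with mean zero and the covariances of
        -- the summands
        IsGaussianProcess (fun (a : closureJ P W Z tstar)
          (x : C(closureJ P W Z tstar, R3)) => x a)
          (μ : Measure C(closureJ P W Z tstar, R3)) ∧
        (∀ (a : closureJ P W Z tstar) (i : Fin 3),
          ∫ x : C(closureJ P W Z tstar, R3), x a i ∂(μ : Measure _) = 0) ∧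
        ∀ (a a' : closureJ P W Z tstar) (i k : Fin 3),
          cov[fun x : C(closureJ P W Z tstar, R3) => x a i,
            fun x : C(closureJ P W Z tstar, R3) => x a' k; (μ : Measure _)] =
          cov[derivTerm P W Z i a, derivTerm P W Z k a'; P] := by
  have hJ := hWZ.intervalJ_eq tstar
  rcases (intervalJ P W Z tstar).eq_empty_or_nonempty with hempty | hne
  · have : IsEmpty (closureJ P W Z tstar) := by simp [closureJ, hempty]
    obtain ⟨Y, -, μ, hμ, hgauss, -, -⟩ := exists_tendstoInDistribution_centredSum (P := P) (W := W)
      (φ := fun _ _ _ ↦ 0) (T := 0) (C := 0) (τ := (0 : C(closureJ P W Z tstar, ℝ))) le_rfl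
      hWZ.measurable_W hWZ.indep_W hWZ.identDistrib_W (fun _ ↦ continuous_const)
      (fun _ _ _ ↦ hasDerivAt_const _ _) (by simp)
      (fun _ _ _ _ ↦ (variance_zero P).le) (by simp [continuous_const])
      isEmptyElim
    exact ⟨Y, fun _ _ a ↦ isEmptyElim a, μ, hμ, hgauss, fun a ↦ isEmptyElim a,
      fun a ↦ isEmptyElim a⟩
  have hlt : deriv (meanLogMgf P W Z) 0 < deriv (meanLogMgf P W Z) tstar := by
    rwa [hJ, Set.nonempty_Ioo] at hne
  have hcl : closureJ P W Z tstar =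
      Set.Icc (deriv (meanLogMgf P W Z) 0) (deriv (meanLogMgf P W Z) tstar) := by
    rw [closureJ, hJ, closure_Ioo hlt.ne]
  have : CompactSpace (closureJ P W Z tstar) := by
    rw [← isCompact_iff_compactSpace, hcl]
    exact isCompact_Icc
  have hpos : ∀ a ∈ Set.Icc (deriv (meanLogMgf P W Z) 0) (deriv (meanLogMgf P W Z) tstar),
      0 < deriv (deriv (meanLogMgf P W Z)) (Function.invFun (deriv (meanLogMgf P W Z)) a) := by
    obtain ⟨c, hc, hca⟩ := hg
    intro a ha
    have := hc.trans (hca a (hcl ▸ ha))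
    rwa [iteratedDeriv_succ, iteratedDeriv_one] at this
  have hcont := hWZ.continuous_deriv_meanLogMgf
  have hmono := hWZ.monotone_deriv_meanLogMgf
  have htilt : ContinuousOn (tilt P W Z) (closureJ P W Z tstar) := by
    rw [hcl]
    exact continuousOn_invFun_Icc htstar.le hcont hmono hpos
  have hsurj : ∀ u ∈ Set.Icc 0 tstar, ∃ a ∈ closureJ P W Z tstar, tilt P W Z a = u := fun u hu ↦
    ⟨_, hcl ▸ ⟨hmono hu.1, hmono hu.2⟩, invFun_apply_of_mem_Icc hmono hpos hu⟩
  have hterm (k : ℕ) (a : ℝ) : derivTerm P W Z k a =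
      fun ω ↦ scaledDeriv (logMgf P Z) k (tilt P W Z a) (W 0 ω) := rfl
  have hmem : ∀ k ≤ 3, ∀ u ∈ Set.Icc 0 tstar,
      MemLp (fun ω ↦ scaledDeriv (logMgf P Z) k u (W 0 ω)) 2 P := by
    intro k hk u hu
    obtain ⟨a, ha, rfl⟩ := hsurj u hu
    exact hcov.memLp k hk a ha
  obtain ⟨C, hC, hC3⟩ := hcov.bound
  have hvar : ∀ k ≤ 3, ∀ u ∈ Set.Icc 0 tstar,
      Var[fun ω ↦ scaledDeriv (logMgf P Z) k u (W 0 ω); P] ≤ C := by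
    intro k hk u hu
    obtain ⟨a, ha, rfl⟩ := hsurj u hu
    obtain hk' | rfl : k ≤ 2 ∨ k = 3 := by omega
    · have := (hC a ha a ha k hk' k hk').le
      rwa [covariance_self (hcov.memLp k hk a ha).aemeasurable] at this
    · exact (hC3 a ha).le
  obtain ⟨Y, hY, μ, hμ, hgauss, hmean, hcovar⟩ := exists_tendstoInDistribution_centredSum
    (φ := scaledDeriv (logMgf P Z)) (τ := ⟨_, htilt.domRestrict⟩) htstar.le hWZ.measurable_W
    hWZ.indep_W hWZ.identDistrib_W (continuous_scaledDeriv hWZ.contDiff_logMgf)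
    (hasDerivAt_scaledDeriv hWZ.contDiff_logMgf) hmem hvar hWZ.continuous_mean
    (fun a ↦ (mapsTo_invFun_Icc htstar.le hcont hmono hpos (hcl ▸ a.2)).1)
  refine ⟨Y, fun n ω a ↦ ?_, μ, hμ, hgauss, hmean, hcovar⟩
  ext i
  rw [hY, hWZ.tripleProcess_apply]
  rfl
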